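/- For a discrete group $G$ let $\mathcal{C}yc$ be the family of all cyclic subgroups of $G$ (finite, trivial or infinite cyclic). A model for the classifying space $E_{\mathcal{C}yc}(G)$ is a $G$-CW-complex $X$ such that the fixed point set $X^H$ is contractible for every cyclic subgroup $H \le G$ and empty for every non-cyclic subgroup $H \le G$; it is finite-dimensional if there is an $N$ such that $X$ has no cells of dimension greater than $N$. (1) If $G$ is a finite group that has a finite-dimensional model for $E_{\mathcal{C}yc}(G)$, then $G$ is cyclic. (2) If $V$ is a virtually cyclic group (that is, $V$ has a cyclic subgroup of finite index), then $V$ has a finite-dimensional model for $E_{\mathcal{C}yc}(V)$ if and only if $V$ is cyclic. -/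

import Mathlib

open Topology Set

universe u v

/-- A family of subgroups of `G`: a set of subgroups that is closed under conjugation and under
taking subgroups. -/
structure SubgroupFamily (G : Type u) [Group G] where
  carrier : Set (Subgroup G)
  conj_mem : ∀ H ∈ carrier, ∀ g : G, H.map (MulAut.conj g).toMonoidHom ∈ carrier
  mem_of_le : ∀ H ∈ carrier, ∀ K : Subgroup G, K ≤ H → K ∈ carrier

/-- The family of all cyclic subgroups of `G` (trivial, finite or infinite cyclic). -/
def cyclicFamily (G : Type u) [Group G] : SubgroupFamily G where
  carrier := {H | IsCyclic H}
  conj_mem := by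
    intro H hH g
    have : IsCyclic H := hH
    exact isCyclic_of_surjective _
      (MonoidHom.subgroupMap_surjective (MulAut.conj g).toMonoidHom H)
  mem_of_le := by
    intro H hH K hK
    have : IsCyclic H := hH
    exact isCyclic_of_injective _ (Subgroup.inclusion_injective hK)

/-- A `G`-CW-complex for a discrete group `G`: a Hausdorff space `X` with a CW structure and an
action of `G` by homeomorphisms which permutes the open `n`-cells for every `n`, and such that an
element of `G` that maps an open cell to itself fixes this cell pointwise.
(Choosing one cell in every orbit, this is the same as building `X` by attaching equivariant cells
`G ⧸ H × Dⁿ`.) -/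
structure IsGCWComplex (G : Type u) [Group G] (X : Type v) [TopologicalSpace X] [MulAction G X]
    [CWComplex (univ : Set X)] : Prop where
  t2Space : T2Space X
  continuousConstSMul : ContinuousConstSMul G X
  smul_openCell : ∀ (g : G) (n : ℕ) (i : RelCWComplex.cell (univ : Set X) n),
    ∃ j : RelCWComplex.cell (univ : Set X) n,
      (fun x : X => g • x) '' RelCWComplex.openCell n i = RelCWComplex.openCell n j
  smul_eq_self : ∀ (g : G) (n : ℕ) (i : RelCWComplex.cell (univ : Set X) n),
    (fun x : X => g • x) '' RelCWComplex.openCell n i = RelCWComplex.openCell n i →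
      ∀ x ∈ RelCWComplex.openCell n i, g • x = x

/-- `X` is a model for the classifying space `E_F G`: a `G`-CW-complex such that the fixed point
set `X^H` is contractible if `H` belongs to the family `F`, and empty otherwise. -/
structure IsClassifyingSpaceModel {G : Type u} [Group G] (F : SubgroupFamily G)
    (X : Type v) [TopologicalSpace X] [MulAction G X] [CWComplex (univ : Set X)] : Prop where
  isGCWComplex : IsGCWComplex G X
  contractible : ∀ H ∈ F.carrier, ContractibleSpace (MulAction.fixedPoints H X)
  empty : ∀ H ∉ F.carrier, MulAction.fixedPoints H X = ∅

/-- `E_F G` has a finite-dimensional model (with underlying space in the universe `v`). -/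
def HasFiniteDimensionalModel {G : Type u} [Group G] (F : SubgroupFamily G) : Prop :=
  ∃ (X : Type v) (_ : TopologicalSpace X) (_ : MulAction G X) (_ : CWComplex (univ : Set X)),
    IsClassifyingSpaceModel F X ∧ CWComplex.FiniteDimensional (univ : Set X)

/-- A group is virtually cyclic if it has a cyclic subgroup of finite index. -/
def IsVirtuallyCyclic (G : Type u) [Group G] : Prop :=
  ∃ H : Subgroup G, IsCyclic H ∧ H.FiniteIndex

/-! For a cyclic group a point is a model. Conversely, let $V$ be virtually cyclic and not cyclic.
Modulo a cyclic normal subgroup of finite index, a minimal subgroup with noncyclic preimage has only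
cyclic proper subgroups, hence is solvable. This gives a cyclic $M$ and an element $t$ normalizing
$M$ with $t^p \in M$, $p$ prime, and $M\langle t\rangle$ not cyclic
(`IsVirtuallyCyclic.exists_not_isCyclic_sup`). In a model, $X^M$ is contractible and $X^{M\langle
t\rangle}$ is empty, so $t$ induces a free action of $\mathbb{Z}/p$ on $X^M$. As in Smith theory,
finite dimension forbids this (`IsGCWComplex.exists_fixedPoint`).

The obstruction is of Borsuk–Ulam type. Thickened cells form a cover of $X$ in which distinct
members of equal dimension are disjoint and arbitrary unions are closed. Labelling a point by the
dimension of the lowest cell near it and the position of that cell in its $t$-orbit gives an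
equivariant labelling of $X^M$ by vertices of the join of $D$ copies of $\mathbb{Z}/p$, locally with
values in a simplex.

By `ListChain.not_semiconj_shift` there is no such labelling. Contractibility produces, degree by
degree, chains of arbitrarily small simplices linked by $\partial x_{n+1} = T_n x_n$, where $T_n$
alternates between the norm and $\tau - 1$. On the join, exactness of these two operators on
alternating cochains produces cochains with $\delta b_n = T_{n+1} b_{n+1}$. The pairing of $b_n$
with $T_n x_n$ is 1 in every degree, but alternating cochains on the join vanish in degree $D$. -/

namespace ListChain

/-! ### Augmented ordered chains and prism operators. -/

section Chains

variable (R : Type*) [CommRing R] {α β γ : Type*}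

/-- The free module on ordered simplices, i.e. lists of vertices. -/
abbrev Chain (R : Type*) [CommRing R] (α : Type*) := List α →₀ R

/-- Add the vertex `a` in front of every simplex. -/
noncomputable def cons (a : α) : Chain R α →ₗ[R] Chain R α := Finsupp.lmapDomain R R (List.cons a)

/-- The chain map induced by a map of vertices. -/
noncomputable def map (f : α → β) : Chain R α →ₗ[R] Chain R β := Finsupp.lmapDomain R R (List.map f)

/-- The alternating sum of the faces of a simplex. -/
noncomputable def boundaryList : List α → Chain R α
  | [] => 0
  | a :: l => Finsupp.single l 1 - cons R a (boundaryList l)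

/-- The boundary operator of the augmented ordered chain complex. -/
noncomputable def boundary : Chain R α →ₗ[R] Chain R α :=
  Finsupp.linearCombination R (boundaryList R)

/-- The prism over a simplex with bottom map `f` and top map `g`. -/
noncomputable def prismList (f g : α → β) : List α → Chain R β
  | [] => 0
  | a :: l => Finsupp.single (f a :: g a :: l.map g) 1 - cons R (f a) (prismList f g l)

/-- The prism operator between the chain maps of `f` and `g`. -/
noncomputable def prism (f g : α → β) : Chain R α →ₗ[R] Chain R β :=
  Finsupp.linearCombination R (prismList R f g)

variable {R}

@[simp] lemma cons_single (a : α) (l : List α) (r : R) :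
    cons R a (Finsupp.single l r) = Finsupp.single (a :: l) r := by
  simp [cons]

@[simp] lemma map_single (f : α → β) (l : List α) (r : R) :
    map R f (Finsupp.single l r) = Finsupp.single (l.map f) r := by
  simp [map]

@[simp] lemma boundary_single (l : List α) :
    boundary R (Finsupp.single l 1) = boundaryList R l := by
  simp [boundary]

@[simp] lemma prism_single (f g : α → β) (l : List α) :
    prism R f g (Finsupp.single l 1) = prismList R f g l := by
  simp [prism]

lemma chain_hom_ext {M : Type*} [AddCommMonoid M] [Module R M] {A B : Chain R α →ₗ[R] M}
    (h : ∀ l, A (Finsupp.single l 1) = B (Finsupp.single l 1)) : A = B :=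
  Finsupp.lhom_ext' fun l => LinearMap.ext_ring (h l)

lemma boundary_cons (a : α) (x : Chain R α) :
    boundary R (cons R a x) = x - cons R a (boundary R x) := by
  have : boundary R ∘ₗ cons R a = LinearMap.id - cons R a ∘ₗ boundary R :=
    chain_hom_ext fun l => by simp [boundaryList]
  exact LinearMap.congr_fun this x

lemma boundary_boundary (x : Chain R α) : boundary R (boundary R x) = 0 := by
  have : boundary R ∘ₗ boundary R = (0 : Chain R α →ₗ[R] Chain R α) := by
    refine chain_hom_ext fun l => ?_
    induction l with
    | nil => simp [boundaryList]
    | cons a l ih =>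
      simp only [LinearMap.comp_apply, boundary_single, LinearMap.zero_apply] at ih ⊢
      simp [boundaryList, boundary_cons, ih]
  exact LinearMap.congr_fun this x

lemma map_cons (f : α → β) (a : α) (x : Chain R α) :
    map R f (cons R a x) = cons R (f a) (map R f x) := by
  have : map R f ∘ₗ cons R a = cons R (f a) ∘ₗ map R f :=
    chain_hom_ext fun l => by simp
  exact LinearMap.congr_fun this x

lemma boundary_map (f : α → β) (x : Chain R α) :
    boundary R (map R f x) = map R f (boundary R x) := by
  have : boundary R ∘ₗ map R f = map R f ∘ₗ boundary R := by
    refine chain_hom_ext fun l => ?_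
    induction l with
    | nil => simp [boundaryList]
    | cons a l ih =>
      simp only [LinearMap.comp_apply, boundary_single, map_single] at ih ⊢
      simp [boundaryList, map_cons, ih]
  exact LinearMap.congr_fun this x

lemma map_map (f : α → β) (g : β → γ) (x : Chain R α) :
    map R g (map R f x) = map R (g ∘ f) x := by
  have : map R g ∘ₗ map R f = map R (g ∘ f) := chain_hom_ext fun l => by simp
  exact LinearMap.congr_fun this x

@[simp] lemma map_id (x : Chain R α) : map R (id : α → α) x = x := by
  have : map R (id : α → α) = LinearMap.id := chain_hom_ext fun l => by simp
  exact LinearMap.congr_fun this x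

lemma prism_cons (f g : α → β) (a : α) (x : Chain R α) :
    prism R f g (cons R a x) =
      cons R (f a) (cons R (g a) (map R g x)) - cons R (f a) (prism R f g x) := by
  have : prism R f g ∘ₗ cons R a =
      cons R (f a) ∘ₗ cons R (g a) ∘ₗ map R g - cons R (f a) ∘ₗ prism R f g :=
    chain_hom_ext fun l => by simp [prismList]
  exact LinearMap.congr_fun this x

lemma boundary_prism (f g : α → β) (x : Chain R α) :
    boundary R (prism R f g x) + prism R f g (boundary R x) = map R g x - map R f x := by
  have : boundary R ∘ₗ prism R f g + prism R f g ∘ₗ boundary R = map R g - map R f := by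
    refine chain_hom_ext fun l => ?_
    induction l with
    | nil => simp [boundaryList, prismList]
    | cons a l ih =>
      simp only [LinearMap.comp_apply, boundary_single, map_single, LinearMap.add_apply,
        LinearMap.sub_apply, prism_single] at ih ⊢
      have h1 : boundary R (prismList R f g l) = Finsupp.single (l.map g) 1 -
        Finsupp.single (l.map f) 1 - prism R f g (boundaryList R l) := by rw [← ih]; abel
      have h2 : boundaryList R (l.map g) = map R g (boundaryList R l) := by
        simpa using boundary_map (R := R) g (Finsupp.single l 1)
      simp only [prismList, boundaryList, map_sub, boundary_cons, h1, prism_cons, h2,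
        boundary_single, prism_single, cons_single, List.map_cons]
      abel
  exact LinearMap.congr_fun this x

/-- Chains in a set of simplices are mapped to chains in a set of simplices if this holds for every
simplex. -/
lemma mem_supported_of_forall {s : Set (List α)} {t : Set (List β)}
    (A : Chain R α →ₗ[R] Chain R β)
    (h : ∀ l ∈ s, A (Finsupp.single l 1) ∈ Finsupp.supported R R t) {x : Chain R α}
    (hx : x ∈ Finsupp.supported R R s) : A x ∈ Finsupp.supported R R t := by
  rw [Finsupp.supported_eq_span_single] at hx
  have : Submodule.span R ((fun i => Finsupp.single i (1 : R)) '' s) ≤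
      (Finsupp.supported R R t).comap A := by
    rw [Submodule.span_le]
    rintro _ ⟨l, hl, rfl⟩
    exact h l hl
  exact this hx

lemma map_mem_supported {s : Set (List α)} {t : Set (List β)} (f : α → β)
    (h : ∀ l ∈ s, l.map f ∈ t) {x : Chain R α} (hx : x ∈ Finsupp.supported R R s) :
    map R f x ∈ Finsupp.supported R R t :=
  mem_supported_of_forall _ (fun l hl => by
    rw [map_single]; exact Finsupp.single_mem_supported R 1 (h l hl)) hx

lemma cons_mem_supported {s : Set (List α)} {t : Set (List α)} (a : α)
    (h : ∀ l ∈ s, a :: l ∈ t) {x : Chain R α} (hx : x ∈ Finsupp.supported R R s) :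
    cons R a x ∈ Finsupp.supported R R t :=
  mem_supported_of_forall _ (fun l hl => by
    rw [cons_single]; exact Finsupp.single_mem_supported R 1 (h l hl)) hx

/-- Every vertex of the prism is a value of `f` or `g` on `l`, so one set containing both images
makes the whole prism small. -/
lemma prismList_mem_supported (f g : α → β) (P : Set β) (l : List α)
    (h : ∀ a ∈ l, f a ∈ P ∧ g a ∈ P) :
    prismList R f g l ∈
      Finsupp.supported R R {m | m.length = l.length + 1 ∧ ∀ b ∈ m, b ∈ P} := by
  induction l with
  | nil => exact Submodule.zero_mem _
  | cons a l ih =>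
    have ha := h a (by simp)
    have hl : ∀ a ∈ l, f a ∈ P ∧ g a ∈ P := fun b hb => h b (by simp [hb])
    refine Submodule.sub_mem _ (Finsupp.single_mem_supported R 1 ⟨by simp, ?_⟩)
      (cons_mem_supported _ ?_ (ih hl))
    · simp only [List.mem_cons, List.mem_map]
      rintro b (rfl | rfl | ⟨c, hc, rfl⟩)
      exacts [ha.1, ha.2, (hl c hc).2]
    · rintro m ⟨hm, hm'⟩
      refine ⟨by simp [hm], ?_⟩
      simp only [List.mem_cons]
      rintro b (rfl | hb)
      exacts [ha.1, hm' b hb]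

end Chains

/-! ### Cochains and the alternating condition. -/

section Cochains

variable {R : Type*} [CommRing R] {α : Type*}

/-- The evaluation of a cochain on chains. -/
noncomputable def eval (f : List α → R) : Chain R α →ₗ[R] R := Finsupp.linearCombination R f

@[simp] lemma eval_single (f : List α → R) (l : List α) (r : R) :
    eval f (Finsupp.single l r) = r * f l := by
  simp [eval]

/-- The operator on cochains that is dual to an operator on chains. -/
noncomputable def dual (A : Chain R α →ₗ[R] Chain R α) (f : List α → R) : List α → R :=
  fun l => eval f (A (Finsupp.single l 1))

lemma eval_dual (A : Chain R α →ₗ[R] Chain R α) (f : List α → R) (x : Chain R α) :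
    eval (dual A f) x = eval f (A x) := by
  have : eval (dual A f) = eval f ∘ₗ A := chain_hom_ext fun l => by simp [dual]
  exact LinearMap.congr_fun this x

lemma dual_dual (A B : Chain R α →ₗ[R] Chain R α) (f : List α → R) :
    dual A (dual B f) = dual (B ∘ₗ A) f := by
  ext l
  rw [dual, eval_dual]
  rfl

lemma eval_congr {f g : List α → R} {s : Set (List α)} (h : ∀ l ∈ s, f l = g l) {x : Chain R α}
    (hx : x ∈ Finsupp.supported R R s) : eval f x = eval g x := by
  simp only [eval, Finsupp.linearCombination_apply]
  exact Finsupp.sum_congr fun l hl => by rw [h l (hx hl)]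

/-- The coboundary. -/
noncomputable abbrev coboundary (f : List α → R) : List α → R := dual (boundary R) f

@[simp] lemma coboundary_nil (f : List α → R) : coboundary f [] = 0 := by
  simp [coboundary, dual, boundaryList]

lemma coboundary_cons (f : List α → R) (a : α) (l : List α) :
    coboundary f (a :: l) = f l - coboundary (fun m => f (a :: m)) l := by
  have : eval f ∘ₗ cons R a = eval (fun m => f (a :: m)) := chain_hom_ext fun m => by simp
  simp only [coboundary, dual, boundary_single, boundaryList, map_sub, eval_single, one_mul]
  rw [← this]
  rfl

lemma coboundary_congr {f g : List α → R} {l : List α} (h : ∀ m, m ⊆ l → f m = g m) :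
    coboundary f l = coboundary g l := by
  induction l generalizing f g with
  | nil => simp
  | cons a l ih =>
    rw [coboundary_cons, coboundary_cons, h l (by simp),
      ih fun m hm => h _ (List.cons_subset_cons a hm)]

lemma coboundary_neg (f : List α → R) (l : List α) :
    coboundary (fun m => - f m) l = - coboundary f l := by
  have : eval (fun m => - f m) = - eval f := chain_hom_ext fun m => by simp
  simp [coboundary, dual, this]

/-- A set of simplices that is given by a condition on the set of vertices and closed under passing
to faces. -/
def IsDownClosed (K : List α → Prop) : Prop := ∀ l m, m ⊆ l → K l → K m

lemma IsDownClosed.cons {K : List α → Prop} (hK : IsDownClosed K) (c : α) :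
    IsDownClosed fun l => K (c :: l) :=
  fun _ _ h => hK _ _ (List.cons_subset_cons c h)

/-- A cochain that is alternating on the simplices in `K`. -/
structure IsAlternating (K : List α → Prop) (f : List α → R) : Prop where
  swap : ∀ u a b v, K (u ++ a :: b :: v) → f (u ++ a :: b :: v) = - f (u ++ b :: a :: v)
  rep : ∀ u a v, K (u ++ a :: a :: v) → f (u ++ a :: a :: v) = 0

lemma IsAlternating.cons {K : List α → Prop} {f : List α → R} (hf : IsAlternating K f) (c : α) :
    IsAlternating (fun l => K (c :: l)) fun l => f (c :: l) :=
  ⟨fun u => hf.swap (c :: u), fun u => hf.rep (c :: u)⟩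

/-- Peeling off a first vertex `c` replaces `f` by `f (c :: ·)` and `K` by the link of `c`, so the
induction on the prefix `u` varies both. For empty `u`, two peelings give $f(bv) - f(av) +
\delta(f(ab\,\cdot))(v)$. -/
lemma IsAlternating.coboundary {K : List α → Prop} (hK : IsDownClosed K) {f : List α → R}
    (hf : IsAlternating K f) : IsAlternating K (coboundary f) := by
  constructor
  · intro u
    induction u generalizing K f with
    | nil =>
      intro a b v h
      simp only [List.nil_append, coboundary_cons] at h ⊢
      have : ListChain.coboundary (fun m => f (a :: b :: m)) v
          = - ListChain.coboundary (fun m => f (b :: a :: m)) v := by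
        rw [← coboundary_neg]
        refine coboundary_congr fun m hm => hf.swap [] a b m (hK _ _ ?_ h)
        exact List.cons_subset_cons a (List.cons_subset_cons b hm)
      rw [this]
      ring
    | cons c u ih =>
      intro a b v h
      simp only [List.cons_append, coboundary_cons] at h ⊢
      rw [hf.swap u a b v (hK _ _ (by simp) h), ih (hK.cons c) (hf.cons c) a b v h]
      ring
  · intro u
    induction u generalizing K f with
    | nil =>
      intro a v h
      simp only [List.nil_append, coboundary_cons] at h ⊢
      have : ListChain.coboundary (fun m => f (a :: a :: m)) v
          = ListChain.coboundary (fun m => 0) v := by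
        refine coboundary_congr fun m hm => hf.rep [] a m (hK _ _ ?_ h)
        exact List.cons_subset_cons a (List.cons_subset_cons a hm)
      rw [this]
      have : eval (fun _ => 0 : List α → R) = 0 := chain_hom_ext fun m => by simp
      simp [dual, this]
    | cons c u ih =>
      intro a v h
      simp only [List.cons_append, coboundary_cons] at h ⊢
      rw [hf.rep u a v (hK _ _ (by simp) h), ih (hK.cons c) (hf.cons c) a v h]
      ring

lemma IsAlternating.perm {K : List α → Prop} (hK : IsDownClosed K) {f : List α → R}
    (hf : IsAlternating K f) {l m : List α} (h : l.Perm m) (hl : K l) :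
    f l = f m ∨ f l = - f m := by
  induction h generalizing K f with
  | nil => exact Or.inl rfl
  | cons x _ ih => exact ih (hK.cons x) (hf.cons x) hl
  | swap x y l => exact Or.inr (hf.swap [] _ _ _ hl)
  | trans h₁ _ ih₁ ih₂ =>
    rcases ih₁ hK hf hl with h | h <;> rcases ih₂ hK hf (hK _ _ h₁.symm.subset hl) with h' | h' <;>
      simp [h, h']

/-- A repeated vertex can be permuted to the two front places at the cost of a sign. Antisymmetry
alone would only give $2f = 0$, which is empty for $p = 2$; hence the separate field `rep`. -/
lemma IsAlternating.eq_zero {K : List α → Prop} (hK : IsDownClosed K) {f : List α → R}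
    (hf : IsAlternating K f) {l : List α} (hl : K l) (hd : ¬ l.Nodup) : f l = 0 := by
  rw [← List.exists_duplicate_iff_not_nodup] at hd
  obtain ⟨a, ha⟩ := hd
  rw [List.duplicate_iff_sublist] at ha
  obtain ⟨v, hv⟩ := ha.exists_perm_append
  have h0 : f ([a, a] ++ v) = 0 := hf.rep [] a v (hK _ _ hv.symm.subset hl)
  rcases hf.perm hK hv hl with h | h <;> simpa [h] using h0

end Cochains

end ListChain

namespace ListChain

/-! ### Norm and difference operators of a cyclic action. -/

section Transfer

variable {R : Type*} [CommRing R] {α β : Type*}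

/-- The norm element (for even `n`) or the difference element (for odd `n`) of the group ring of the
cyclic group of order `p` whose generator acts through `τ`. -/
noncomputable def transfer (R : Type*) [CommRing R] (p : ℕ) (τ : α → α) (n : ℕ) :
    Chain R α →ₗ[R] Chain R α :=
  if Even n then ∑ i ∈ Finset.range p, map R τ^[i] else map R τ - LinearMap.id

lemma transfer_even (p : ℕ) (τ : α → α) {n : ℕ} (hn : Even n) (x : Chain R α) :
    transfer R p τ n x = ∑ i ∈ Finset.range p, map R τ^[i] x := by
  simp [transfer, hn]

lemma transfer_odd (p : ℕ) (τ : α → α) {n : ℕ} (hn : ¬ Even n) (x : Chain R α) :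
    transfer R p τ n x = map R τ x - x := by
  simp [transfer, hn]

lemma transfer_add_two (p : ℕ) (τ : α → α) (n : ℕ) :
    transfer R p τ (n + 2) = transfer R p τ n := by
  simp [transfer, Nat.even_add]

lemma boundary_transfer (p : ℕ) (τ : α → α) (n : ℕ) (x : Chain R α) :
    boundary R (transfer R p τ n x) = transfer R p τ n (boundary R x) := by
  by_cases hn : Even n
  · simp [transfer_even _ _ hn, boundary_map]
  · simp [transfer_odd _ _ hn, boundary_map]

lemma map_transfer (p : ℕ) {σ : α → α} {τ : β → β} {f : α → β} (h : Function.Semiconj f σ τ)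
    (n : ℕ) (x : Chain R α) :
    map R f (transfer R p σ n x) = transfer R p τ n (map R f x) := by
  by_cases hn : Even n
  · simp [transfer_even _ _ hn, map_map, fun i => (h.iterate_right i).comp_eq]
  · simp [transfer_odd _ _ hn, map_map, h.comp_eq]

lemma sum_map_iterate_succ_sub {p : ℕ} {τ : α → α} (hτ : τ^[p] = id) (x : Chain R α) :
    ∑ i ∈ Finset.range p, (map R τ^[i + 1] x - map R τ^[i] x) = 0 := by
  rw [Finset.sum_range_sub (fun i => map R τ^[i] x), hτ]
  simp

/-- In either order the product of the norm and $\tau - 1$ telescopes to $\tau^p - 1$. -/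
lemma transfer_transfer {p : ℕ} {τ : α → α} (hτ : τ^[p] = id) (n : ℕ) (x : Chain R α) :
    transfer R p τ (n + 1) (transfer R p τ n x) = 0 := by
  rw [← sum_map_iterate_succ_sub hτ x]
  by_cases hn : Even n
  · have hn' : ¬ Even (n + 1) := by simpa [Nat.even_add_one] using hn
    simp only [transfer_even _ _ hn, transfer_odd _ _ hn', map_sum, map_map,
      ← Function.iterate_succ', Finset.sum_sub_distrib]
  · have hn' : Even (n + 1) := by simpa [Nat.even_add_one] using hn
    simp [transfer_odd _ _ hn, transfer_even _ _ hn', map_map, Function.iterate_succ]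

lemma transfer_mem_supported (p : ℕ) (τ : α → α) {s t : Set (List α)}
    (h : ∀ l ∈ s, ∀ i, l.map τ^[i] ∈ t) (n : ℕ) {x : Chain R α}
    (hx : x ∈ Finsupp.supported R R s) :
    transfer R p τ n x ∈ Finsupp.supported R R t := by
  by_cases hn : Even n
  · rw [transfer_even _ _ hn]
    exact Submodule.sum_mem _ fun i _ => map_mem_supported _ (fun l hl => h l hl i) hx
  · rw [transfer_odd _ _ hn]
    refine Submodule.sub_mem _ (map_mem_supported _ (fun l hl => h l hl 1) hx) ?_
    simpa using map_mem_supported (t := t) id (fun l hl => h l hl 0) hx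

lemma dual_transfer_even (p : ℕ) (τ : α → α) {n : ℕ} (hn : Even n) (f : List α → R) (l : List α) :
    dual (transfer R p τ n) f l = ∑ i ∈ Finset.range p, f (l.map τ^[i]) := by
  simp [dual, transfer_even _ _ hn]

lemma dual_transfer_odd (p : ℕ) (τ : α → α) {n : ℕ} (hn : ¬ Even n) (f : List α → R) (l : List α) :
    dual (transfer R p τ n) f l = f (l.map τ) - f l := by
  simp [dual, transfer_odd _ _ hn]

lemma coboundary_dual_transfer (p : ℕ) (τ : α → α) (n : ℕ) (f : List α → R) :
    coboundary (dual (transfer R p τ n) f) = dual (transfer R p τ n) (coboundary f) := by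
  rw [coboundary, dual_dual, coboundary, dual_dual]
  congr 1
  ext1 l
  ext1
  simp [boundary_transfer]

lemma coboundary_coboundary (f : List α → R) : coboundary (coboundary f) = 0 := by
  ext l
  rw [coboundary, dual, eval_dual, boundary_boundary, map_zero]
  rfl

end Transfer

/-! ### The join of copies of the cyclic group and its equivariant cochains. -/

section Join

variable {R : Type*} [CommRing R] {p : ℕ}

/-- The vertices of the join of copies of the cyclic group of order `p`, indexed by colours. -/
abbrev Vertex (p : ℕ) := ℕ × ZMod p

/-- The generator of the cyclic group acting on the join. -/
def shift (p : ℕ) (v : Vertex p) : Vertex p := (v.1, v.2 + 1)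

lemma shift_iterate (v : Vertex p) (i : ℕ) : (shift p)^[i] v = (v.1, v.2 + i) := by
  induction i with
  | zero => simp
  | succ i ih => rw [Function.iterate_succ_apply', ih]; simp [shift, add_assoc]

lemma shift_iterate_self : (shift p)^[p] = id := by
  ext v <;> simp [shift_iterate]

/-- The simplices of the join of the copies with colours less than `D`: every colour occurs at most
once. -/
def IsSimplex (p D : ℕ) (l : List (Vertex p)) : Prop :=
  (∀ u ∈ l, u.1 < D) ∧ ∀ u ∈ l, ∀ w ∈ l, u.1 = w.1 → u = w

lemma isDownClosed_isSimplex (D : ℕ) : IsDownClosed (IsSimplex p D) :=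
  fun _ _ h hl => ⟨fun u hu => hl.1 u (h hu), fun u hu w hw => hl.2 u (h hu) w (h hw)⟩

lemma IsSimplex.map_shift {D : ℕ} {l : List (Vertex p)} (hl : IsSimplex p D l) (i : ℕ) :
    IsSimplex p D (l.map (shift p)^[i]) := by
  constructor
  · simp only [List.mem_map, forall_exists_index, and_imp, forall_apply_eq_imp_iff₂, shift_iterate]
    exact hl.1
  · simp only [List.mem_map, forall_exists_index, and_imp, forall_apply_eq_imp_iff₂, shift_iterate]
    intro u hu w hw h
    rw [hl.2 u hu w hw h]

/-- Pigeonhole on the `D` colours. With `IsAlternating.eq_zero` this is where finite dimension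
enters. -/
lemma IsSimplex.not_nodup {D : ℕ} {l : List (Vertex p)} (hl : IsSimplex p D l)
    (h : D < l.length) : ¬ l.Nodup := by
  intro hn
  have h1 : (l.map Prod.fst).Nodup := hn.map_on fun u hu w hw => hl.2 u hu w hw
  have h2 : (l.map Prod.fst).toFinset ⊆ Finset.range D := by
    intro k hk
    simp only [List.mem_toFinset, List.mem_map] at hk
    obtain ⟨u, hu, rfl⟩ := hk
    exact Finset.mem_range.2 (hl.1 u hu)
  have h3 := Finset.card_le_card h2
  rw [List.toFinset_card_of_nodup h1, List.length_map, Finset.card_range] at h3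
  omega

lemma IsAlternating.map_shift {D : ℕ} {f : List (Vertex p) → R}
    (hf : IsAlternating (IsSimplex p D) f) (i : ℕ) :
    IsAlternating (IsSimplex p D) fun l => f (l.map (shift p)^[i]) := by
  constructor
  · intro u a b v h
    have := h.map_shift i
    simp only [List.map_append, List.map_cons] at this ⊢
    exact hf.swap _ _ _ _ this
  · intro u a v h
    have := h.map_shift i
    simp only [List.map_append, List.map_cons] at this ⊢
    exact hf.rep _ _ _ this

open Classical in
/-- The indicator function of a fundamental domain: the vertex of the smallest colour is the neutral
element. -/
noncomputable def fundamental (R : Type*) [CommRing R] (l : List (Vertex p)) : R :=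
  if ∃ u ∈ l, u.2 = 0 ∧ ∀ w ∈ l, u.1 ≤ w.1 then 1 else 0

lemma fundamental_congr {l m : List (Vertex p)} (h : ∀ u, u ∈ l ↔ u ∈ m) :
    fundamental R l = fundamental R m := by
  simp only [fundamental, h]

/-- The action is free on nonempty simplices: if `u` is the vertex of smallest colour, only the
translate by `-u.2` moves it to the neutral element. -/
lemma sum_fundamental [NeZero p] {D : ℕ} {l : List (Vertex p)} (hl : IsSimplex p D l)
    (hne : l ≠ []) :
    ∑ i ∈ Finset.range p, fundamental R (l.map (shift p)^[i]) = 1 := by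
  obtain ⟨u, hu, hmin⟩ : ∃ u ∈ l, ∀ w ∈ l, u.1 ≤ w.1 := by
    have hne' : l.toFinset.Nonempty := by simpa using hne
    simpa using Finset.exists_min_image l.toFinset Prod.fst hne'
  have key : ∀ i, fundamental R (l.map (shift p)^[i]) = if u.2 + i = 0 then 1 else 0 := by
    intro i
    unfold fundamental
    congr 1
    simp only [List.mem_map, exists_exists_and_eq_and, forall_exists_index, and_imp,
      forall_apply_eq_imp_iff₂, shift_iterate, eq_iff_iff]
    constructor
    · rintro ⟨w, hw, hw0, hwm⟩
      rwa [hl.2 u hu w hw (le_antisymm (hmin w hw) (hwm u hu))]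
    · intro h0
      exact ⟨u, hu, h0, hmin⟩
  simp only [key]
  rw [Finset.sum_eq_single_of_mem (-u.2).val (Finset.mem_range.2 (ZMod.val_lt _))]
  · simp
  · intro i hi hne
    refine if_neg fun h => hne ?_
    rw [neg_eq_of_add_eq_zero_right h, ZMod.val_natCast, Nat.mod_eq_of_lt (Finset.mem_range.1 hi)]

/-- The indicator depends only on the set of vertices, so it is unchanged by a transposition. -/
lemma IsAlternating.fundamental_mul {D : ℕ} {f : List (Vertex p) → R}
    (hf : IsAlternating (IsSimplex p D) f) (i : ℕ) :
    IsAlternating (IsSimplex p D) fun l => fundamental R (l.map (shift p)^[i]) * f l := by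
  constructor
  · intro u a b v h
    rw [hf.swap _ _ _ _ h, fundamental_congr (m := (u ++ b :: a :: v).map (shift p)^[i])]
    · ring
    · intro w
      simp only [List.mem_map, List.mem_append, List.mem_cons]
      grind
  · intro u a v h
    simp [hf.rep _ _ _ h]

lemma IsAlternating.sum {ι : Type*} {K : List (Vertex p) → Prop} (s : Finset ι)
    {f : ι → List (Vertex p) → R} (hf : ∀ i ∈ s, IsAlternating K (f i)) :
    IsAlternating K fun l => ∑ i ∈ s, f i l := by
  constructor
  · intro u a b v h
    rw [← Finset.sum_neg_distrib]
    exact Finset.sum_congr rfl fun i hi => (hf i hi).swap _ _ _ _ h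
  · intro u a v h
    exact Finset.sum_eq_zero fun i hi => (hf i hi).rep _ _ _ h

lemma IsAlternating.neg {K : List (Vertex p) → Prop} {f : List (Vertex p) → R}
    (hf : IsAlternating K f) : IsAlternating K fun l => - f l :=
  ⟨fun u a b v h => by rw [hf.swap _ _ _ _ h], fun u a v h => by rw [hf.rep _ _ _ h, neg_zero]⟩

/-- The kernel of one of norm and difference on alternating cochains is the image of the other. -/
lemma exists_dual_transfer_eq [NeZero p] [CharP R p] {D : ℕ} (n : ℕ) {f : List (Vertex p) → R}
    (hf : IsAlternating (IsSimplex p D) f) (hf0 : f [] = 0)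
    (h : ∀ l, IsSimplex p D l → dual (transfer R p (shift p) (n + 1)) f l = 0) :
    ∃ g, IsAlternating (IsSimplex p D) g ∧
      ∀ l, IsSimplex p D l → dual (transfer R p (shift p) n) g l = f l := by
  by_cases hn : Even n
  · have hn' : ¬ Even (n + 1) := by simpa [Nat.even_add_one] using hn
    -- Here `f` is invariant, and cutting it down to the fundamental domain gives a cochain with
    -- norm `f`.
    refine ⟨_, hf.fundamental_mul 0, fun l hl => ?_⟩
    rw [dual_transfer_even _ _ hn]
    rcases eq_or_ne l [] with rfl | hne
    · simp [hf0]
    have hinv : ∀ i, f (l.map (shift p)^[i]) = f l := by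
      intro i
      induction i with
      | zero => simp
      | succ i ih =>
        have := h _ (hl.map_shift i)
        rw [dual_transfer_odd _ _ hn', List.map_map, ← Function.iterate_succ'] at this
        rw [sub_eq_zero.1 this, ih]
    simp only [hinv, ← Finset.sum_mul, Function.iterate_zero, List.map_id, sum_fundamental hl hne,
      one_mul]
  · have hn' : Even (n + 1) := by simpa [Nat.even_add_one] using hn
    -- Here `f` has norm zero. The witness is $-\sum_i F_i s_i$, with $F_i$ the indicator on the
    -- $i$-th translate and $s_i$ the sum of the first $i$ translates of `f`.
    refine ⟨_, (IsAlternating.sum (Finset.range p) fun i _ =>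
      (IsAlternating.sum (Finset.range i) fun j _ => hf.map_shift j).fundamental_mul i).neg,
      fun l hl => ?_⟩
    rw [dual_transfer_odd _ _ hn]
    rcases eq_or_ne l [] with rfl | hne
    · simp [hf0]
    have hN := h l hl
    rw [dual_transfer_even _ _ hn'] at hN
    set s : ℕ → R := fun i => ∑ j ∈ Finset.range i, f (l.map (shift p)^[j]) with hs
    set F : ℕ → R := fun i => fundamental R (l.map (shift p)^[i]) with hF
    have h1 : ∀ i, ∑ j ∈ Finset.range i, f ((l.map (shift p)).map (shift p)^[j]) =
        s (i + 1) - f l := by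
      intro i
      rw [hs]
      simp only [List.map_map, ← Function.iterate_succ]
      rw [Finset.sum_range_succ' (fun j => f (l.map (shift p)^[j]))]
      simp
    have h2 : ∀ i, fundamental R ((l.map (shift p)).map (shift p)^[i]) = F (i + 1) := by
      intro i
      simp only [hF, List.map_map, ← Function.iterate_succ]
    -- Both ends of the telescope vanish: $s_0$ is an empty sum and $s_p$ is the norm of `f`.
    have h3 : ∑ i ∈ Finset.range p, (F (i + 1) * s (i + 1) - F i * s i) = 0 := by
      rw [Finset.sum_range_sub (fun i => F i * s i)]
      simp [hs, hN]
    have h4 : ∑ i ∈ Finset.range p, F (i + 1) = 1 := by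
      have : ∑ i ∈ Finset.range p, (F (i + 1) - F i) = 0 := by
        rw [Finset.sum_range_sub]
        simp [hF, shift_iterate_self]
      rw [Finset.sum_sub_distrib, sub_eq_zero] at this
      rw [this]
      exact sum_fundamental hl hne
    simp only [h1, h2]
    rw [Finset.sum_sub_distrib, sub_eq_zero] at h3
    simp only [mul_sub, Finset.sum_sub_distrib, ← Finset.sum_mul, h4, h3]
    ring

end Join

end ListChain

namespace ListChain

/-! ### Small simplices in a contractible space and the obstruction. -/

section Small

variable {R : Type*} [CommRing R] {Y : Type*}

/-- The ordered simplices with `n` vertices that lie in one of the sets `U y`. -/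
def smallLists (U : Y → Set Y) (n : ℕ) : Set (List Y) :=
  {l | l.length = n ∧ ∃ y, ∀ a ∈ l, a ∈ U y}

variable [TopologicalSpace Y]

/-- For every neighbourhood assignment `U` on a contractible space there is another one, `V`, such
that every cycle of `V`-small simplices bounds a chain of `U`-small simplices. -/
lemma exists_refinement_boundary [ContractibleSpace Y] (U : Y → Set Y) (hU : ∀ y, U y ∈ 𝓝 y) :
    ∃ V : Y → Set Y, (∀ y, V y ∈ 𝓝 y) ∧
      ∀ n, ∀ z ∈ Finsupp.supported R R (smallLists V n), boundary R z = 0 →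
        ∃ w ∈ Finsupp.supported R R (smallLists U (n + 1)), boundary R w = z := by
  classical
  obtain ⟨c, ⟨H⟩⟩ := id_nullhomotopic Y
  -- Compactness of the interval gives one neighbourhood of `y` that stays `U`-small at every time
  -- of the contraction; it must not depend on the cycle.
  have tube : ∀ y, ∃ V ∈ 𝓝 y, ∀ t : unitInterval, ∃ u, ∀ x ∈ V, H (t, x) ∈ interior (U u) := by
    intro y
    have := isCompact_univ.induction_on (X := unitInterval)
      (p := fun S => ∃ V ∈ 𝓝 y, ∀ t ∈ S, ∃ u, ∀ x ∈ V, H (t, x) ∈ interior (U u))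
      ⟨univ, Filter.univ_mem, by simp⟩
      (fun S T hST ⟨V, hV, h⟩ => ⟨V, hV, fun t ht => h t (hST ht)⟩)
      (fun S T ⟨V, hV, h⟩ ⟨W, hW, h'⟩ => ⟨V ∩ W, Filter.inter_mem hV hW, fun t ht => by
        rcases ht with ht | ht
        · obtain ⟨u, hu⟩ := h t ht
          exact ⟨u, fun x hx => hu x hx.1⟩
        · obtain ⟨u, hu⟩ := h' t ht
          exact ⟨u, fun x hx => hu x hx.2⟩⟩)
      (fun t _ => by
        have h1 : (fun q => H q) ⁻¹' interior (U (H (t, y))) ∈ 𝓝 (t, y) :=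
          H.continuous.continuousAt.preimage_mem_nhds (interior_mem_nhds.2 (hU _))
        rw [nhds_prod_eq, Filter.mem_prod_iff] at h1
        obtain ⟨S, hS, V, hV, hSV⟩ := h1
        exact ⟨S, by simpa using hS, V, hV, fun s hs => ⟨_, fun x hx => hSV ⟨hs, hx⟩⟩⟩)
    obtain ⟨V, hV, h⟩ := this
    exact ⟨V, hV, fun t => h t (mem_univ t)⟩
  choose V hV htube using tube
  refine ⟨V, hV, fun n z hz hz0 => ?_⟩
  set B := (Finsupp.supported R R (smallLists U (n + 1))).map (boundary R)
  let h : unitInterval → Y → Y := fun t x => H (t, x)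
  -- For `t` close to `s` the prism is `U`-small, since `z` involves finitely many vertices;
  -- connectedness of the interval then links any two times.
  have key : ∀ s t, map R (h t) z - map R (h s) z ∈ B := by
    have hloc : ∀ s, ∀ᶠ t in 𝓝 s, map R (h t) z - map R (h s) z ∈ B := by
      intro s
      have h1 : ∀ᶠ t in 𝓝 s, ∀ l ∈ z.support, ∃ u, ∀ a ∈ l, h s a ∈ U u ∧ h t a ∈ U u := by
        rw [Filter.eventually_all_finset]
        intro l hl
        obtain ⟨-, y, hy⟩ := hz hl
        obtain ⟨u, hu⟩ := htube y s
        have h2 : ∀ᶠ t in 𝓝 s, ∀ a ∈ l.toFinset, h t a ∈ interior (U u) := by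
          rw [Filter.eventually_all_finset]
          intro a ha
          have hcont : Continuous fun t => h t a := by fun_prop
          exact hcont.continuousAt.preimage_mem_nhds
            (isOpen_interior.mem_nhds (hu a (hy a (by simpa using ha))))
        filter_upwards [h2] with t ht
        exact ⟨u, fun a ha =>
          ⟨interior_subset (hu a (hy a ha)), interior_subset (ht a (by simpa using ha))⟩⟩
      filter_upwards [h1] with t ht
      refine ⟨prism R (h s) (h t) z, ?_, ?_⟩
      · refine mem_supported_of_forall (s := (z.support : Set (List Y))) _ ?_
          ((Finsupp.mem_supported R z).2 subset_rfl)
        intro l hl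
        obtain ⟨u, hu⟩ := ht l hl
        rw [prism_single]
        refine Finsupp.supported_mono ?_ (prismList_mem_supported _ _ (U u) l hu)
        rintro m ⟨hm, hm'⟩
        exact ⟨by rw [hm, (hz hl).1], u, hm'⟩
      · simpa [hz0] using boundary_prism (h s) (h t) z
    intro s t
    refine PreconnectedSpace.induction₂' (fun s t => map R (h t) z - map R (h s) z ∈ B)
      (fun s => ?_) ⟨fun a b c hab hbc => ?_⟩ s t
    · filter_upwards [hloc s] with t ht
      refine ⟨ht, ?_⟩
      rw [← neg_sub]
      exact B.neg_mem ht
    · rw [← sub_add_sub_cancel]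
      exact B.add_mem hbc hab
  have h0 : h 0 = id := by
    ext x
    simp [h]
  have h1 : h 1 = fun _ => c := by
    ext x
    simp [h]
  -- At the end of the contraction all vertices are `c`, and the cone with apex `c` is a filling.
  have hB : map R (h 1) z ∈ B := by
    refine ⟨cons R c (map R (h 1) z), ?_, ?_⟩
    · refine cons_mem_supported (s := {l | l.length = n ∧ ∀ a ∈ l, a = c}) c ?_
        (map_mem_supported _ ?_ hz)
      · rintro l ⟨hl, hl'⟩
        refine ⟨by simp [hl], c, ?_⟩
        simp only [List.mem_cons, forall_eq_or_imp]
        refine ⟨mem_of_mem_nhds (hU c), fun a ha => ?_⟩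
        rw [hl' a ha]
        exact mem_of_mem_nhds (hU c)
      · rintro l ⟨hl, -⟩
        refine ⟨by simp [hl], ?_⟩
        simp [h1]
    · rw [boundary_cons, boundary_map, hz0]
      simp
  have := B.sub_mem hB (key 0 1)
  rwa [h0, map_id, sub_sub_cancel] at this

variable {p : ℕ}

/-- A continuous map of period `p` of a contractible space that has an equivariant map to the join
of finitely many copies of the cyclic group of order `p`, locally with values in a simplex, does not
exist. -/
theorem not_semiconj_shift [NeZero p] [Fact (1 < p)] [ContractibleSpace Y] {h : Y → Y}
    (hh : Continuous h) (hp : h^[p] = id) (D : ℕ) (lab : Y → Vertex p)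
    (hD : ∀ y, (lab y).1 < D) (hlab : Function.Semiconj lab h (shift p))
    (hloc : ∀ y, ∃ W ∈ 𝓝 y, ∀ a ∈ W, ∀ b ∈ W, (lab a).1 = (lab b).1 → lab a = lab b) : False := by
  let R := ZMod p
  choose W hW hWlab using hloc
  have hsimp : ∀ n, ∀ l ∈ smallLists W n, IsSimplex p D (l.map lab) := by
    rintro n l ⟨-, y, hy⟩
    constructor
    · simp only [List.mem_map, forall_exists_index, and_imp, forall_apply_eq_imp_iff₂]
      exact fun a _ => hD a
    · simp only [List.mem_map, forall_exists_index, and_imp, forall_apply_eq_imp_iff₂]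
      exact fun a ha b hb => hWlab y a (hy a ha) b (hy b hb)
  have htr : ∀ U : Y → Set Y, (∀ y, U y ∈ 𝓝 y) → ∃ V : Y → Set Y, (∀ y, V y ∈ 𝓝 y) ∧
      (∀ y, V y ⊆ W y) ∧ ∀ n, ∀ l ∈ smallLists V n, ∀ i, l.map h^[i] ∈ smallLists U n := by
    intro U hU
    refine ⟨fun y => W y ∩ ⋂ i ∈ Finset.range p, h^[i] ⁻¹' U (h^[i] y), fun y => ?_,
      fun y => inter_subset_left, ?_⟩
    · refine Filter.inter_mem (hW y) ((Filter.biInter_finset_mem _).2 fun i _ => ?_)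
      exact (hh.iterate i).continuousAt.preimage_mem_nhds (hU _)
    · rintro n l ⟨hl, y, hy⟩ i
      -- Only exponents below `p` occur in the intersection; periodicity reduces the others to
      -- these.
      refine ⟨by simp [hl], h^[i % p] y, ?_⟩
      have hi : h^[i] = h^[i % p] := by
        conv_lhs => rw [← Nat.mod_add_div i p, Function.iterate_add, Function.iterate_mul, hp]
        simp
      simp only [List.mem_map, forall_exists_index, and_imp, forall_apply_eq_imp_iff₂]
      intro a ha
      have := (hy a ha).2
      simp only [mem_iInter, Finset.mem_range] at this
      rw [hi]
      exact this _ (Nat.mod_lt _ (NeZero.pos p))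
  -- The cochain `b` is chosen before `U`, while the chain `x` may depend on `U`: each induction
  -- step needs `x` for a finer assignment.
  have claim : ∀ n, ∃ b : List (Vertex p) → R, IsAlternating (IsSimplex p D) b ∧
      (∀ l, IsSimplex p D l → coboundary (dual (transfer R p (shift p) n) b) l = 0) ∧
      ∀ U : Y → Set Y, (∀ y, U y ∈ 𝓝 y) → (∀ y, U y ⊆ W y) →
        ∃ x ∈ Finsupp.supported R R (smallLists U (n + 1)),
          boundary R (transfer R p h n x) = 0 ∧
          eval b (transfer R p (shift p) n (map R lab x)) = 1 := by
    intro n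
    induction n with
    | zero =>
      classical
      -- The dual of the empty simplex: its coboundary is the invariant cocycle with value 1 on
      -- every vertex, and `b` is chosen with norm equal to it.
      let e : List (Vertex p) → R := fun l => if l = [] then 1 else 0
      have he : IsAlternating (IsSimplex p D) e := ⟨by simp [e], by simp [e]⟩
      have he1 : ∀ v : Vertex p, coboundary e [v] = 1 := by
        intro v
        simp [coboundary_cons, e]
      have heinv : ∀ l, coboundary e (l.map (shift p)) = coboundary e l := by
        intro l
        rcases l with _ | ⟨a, l⟩
        · rfl
        have : ∀ a : Vertex p, coboundary (fun m => e (a :: m)) = 0 := by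
          intro a
          have : (fun m => e (a :: m)) = fun _ => 0 := by simp [e]
          rw [this]
          ext l
          have : eval (fun _ => 0 : List (Vertex p) → R) = 0 := chain_hom_ext fun m => by simp
          simp [dual, this]
        simp only [List.map_cons, coboundary_cons, this]
        simp [e]
      obtain ⟨b, hb, hb'⟩ := exists_dual_transfer_eq 0
        (he.coboundary (isDownClosed_isSimplex D)) (coboundary_nil e)
        (fun l _ => by rw [dual_transfer_odd _ _ (by simp), heinv, sub_self])
      refine ⟨b, hb, fun l hl => ?_, fun U hU hUW => ?_⟩
      · rw [coboundary_congr (g := coboundary e)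
          (fun m hm => hb' m (isDownClosed_isSimplex D _ _ hm hl)), coboundary_coboundary]
        rfl
      · obtain ⟨y⟩ : Nonempty Y := inferInstance
        have hy : [y] ∈ smallLists U 1 := ⟨rfl, y, by simpa using mem_of_mem_nhds (hU y)⟩
        refine ⟨Finsupp.single [y] 1, Finsupp.single_mem_supported R 1 hy, ?_, ?_⟩
        -- The norm of a point has augmentation `p`, which is zero in `ZMod p`.
        · rw [boundary_transfer, boundary_single]
          simp [boundaryList, transfer_even, R]
        · rw [← eval_dual, map_single, eval_single, one_mul, List.map_singleton, hb', he1]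
          exact hsimp 1 [y] ⟨rfl, y, by simpa using mem_of_mem_nhds (hW y)⟩
    | succ n ih =>
      -- On the join, $T_{n+2}\,\delta b = \delta(T_n b) = 0$, so exactness gives $\delta b =
      -- T_{n+1} b'$. In the space, $T_n x$ is a small cycle and bounds some $w$. Then $b'(T_{n+1}
      -- w) = \delta b(w) = b(T_n x) = 1$.
      obtain ⟨b, hb, hcb, hx⟩ := ih
      obtain ⟨b', hb', hbb'⟩ := exists_dual_transfer_eq (n + 1)
        (hb.coboundary (isDownClosed_isSimplex D)) (coboundary_nil b)
        (fun l hl => by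
          rw [transfer_add_two, ← coboundary_dual_transfer, hcb l hl])
      refine ⟨b', hb', fun l hl => ?_, fun U hU hUW => ?_⟩
      · rw [coboundary_congr (g := coboundary b)
          (fun m hm => hbb' m (isDownClosed_isSimplex D _ _ hm hl)), coboundary_coboundary]
        rfl
      · obtain ⟨V, hV, hVU⟩ := exists_refinement_boundary (R := R) U hU
        obtain ⟨V', hV', hVW, hVV'⟩ := htr V hV
        obtain ⟨x, hxV, hx0, hx1⟩ := hx V' hV' hVW
        obtain ⟨w, hw, hwx⟩ := hVU (n + 1) (transfer R p h n x)
          (transfer_mem_supported _ _ (hVV' (n + 1)) n hxV) hx0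
        refine ⟨w, hw, ?_, ?_⟩
        · rw [boundary_transfer, hwx, transfer_transfer hp]
        · have hw' : map R lab w ∈ Finsupp.supported R R {l | IsSimplex p D l} := by
            refine map_mem_supported (s := smallLists U (n + 1 + 1)) _ (fun l hl => ?_) hw
            obtain ⟨y, hy⟩ := hl.2
            exact hsimp (n + 1 + 1) l ⟨hl.1, y, fun a ha => hUW y (hy a ha)⟩
          rw [← eval_dual, eval_congr hbb' hw', eval_dual, boundary_map, hwx, map_transfer p hlab,
            hx1]
  -- In degree `D` a simplex has `D + 1` vertices but only `D` colours, so `b` vanishes on it.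
  obtain ⟨b, hb, -, hx⟩ := claim D
  obtain ⟨x, hxW, -, hx1⟩ := hx W hW (fun _ => subset_rfl)
  have hx' : map R lab x ∈ Finsupp.supported R R {l | IsSimplex p D l ∧ l.length = D + 1} :=
    map_mem_supported (s := smallLists W (D + 1)) (t := {l | IsSimplex p D l ∧ l.length = D + 1}) _
      (fun l hl => ⟨hsimp _ l hl, by simp [hl.1]⟩) hxW
  have hx'' := transfer_mem_supported p (shift p)
    (t := {l | IsSimplex p D l ∧ l.length = D + 1})
    (fun l hl i => ⟨hl.1.map_shift i, by simp [hl.2]⟩) D hx'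
  rw [eval_congr (g := fun _ => 0) (fun l hl => hb.eq_zero (isDownClosed_isSimplex D) hl.1
    (hl.1.not_nodup (by simp [hl.2]))) hx''] at hx1
  have : eval (fun _ => 0 : List (Vertex p) → R) = 0 := chain_hom_ext fun m => by simp
  rw [this] at hx1
  exact zero_ne_one hx1

end Small

end ListChain

namespace IsGCWComplex

open RelCWComplex Metric

/-! ### Cells, characteristic maps and the dimension of a point. -/

section Cells

variable {X : Type v} [TopologicalSpace X] [CWComplex (univ : Set X)]

/-- The cells of all dimensions of a CW-complex. -/
abbrev Cell (X : Type v) [TopologicalSpace X] [CWComplex (univ : Set X)] : Type v :=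
  Σ n, RelCWComplex.cell (univ : Set X) n

/-- The open cell as a set of points. -/
abbrev pts (c : Cell X) : Set X := openCell c.1 c.2

/-- The characteristic map of a cell. -/
noncomputable abbrev charMap (c : Cell X) (v : Fin c.1 → ℝ) : X :=
  RelCWComplex.map (C := (univ : Set X)) c.1 c.2 v

lemma eq_of_mem_pts {x : X} {c d : Cell X} (hc : x ∈ pts c) (hd : x ∈ pts d) : c = d :=
  eq_of_not_disjoint_openCell (not_disjoint_iff.2 ⟨x, hc, hd⟩)

lemma eq_of_pts_eq {c d : Cell X} (h : pts c = pts d) : c = d := by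
  obtain ⟨x, hx⟩ := openCell_nonempty c.1 c.2
  exact eq_of_mem_pts hx (h ▸ hx)

lemma charMap_mem_pts (c : Cell X) {v : Fin c.1 → ℝ} (hv : ‖v‖ < 1) : charMap c v ∈ pts c :=
  mem_image_of_mem _ (by simpa using hv)

lemma charMap_mem_closedCell (c : Cell X) {v : Fin c.1 → ℝ} (hv : ‖v‖ ≤ 1) :
    charMap c v ∈ closedCell c.1 c.2 :=
  mem_image_of_mem _ (by simpa using hv)

lemma charMap_injOn (c : Cell X) {v w : Fin c.1 → ℝ} (hv : ‖v‖ < 1) (hw : ‖w‖ < 1)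
    (h : charMap c v = charMap c w) : v = w := by
  refine (RelCWComplex.map (C := (univ : Set X)) c.1 c.2).injOn ?_ ?_ h <;>
  rw [source_eq] <;> simpa

lemma exists_mem_pts (x : X) : ∃ c : Cell X, x ∈ pts c := by
  have : x ∈ ⋃ (n : ℕ) (j : cell (univ : Set X) n), openCell n j := by
    rw [CWComplex.iUnion_openCell_eq_complex]
    trivial
  simp only [mem_iUnion] at this
  obtain ⟨n, j, h⟩ := this
  exact ⟨⟨n, j⟩, h⟩

/-- The dimension of the open cell that contains `x`. -/
noncomputable def rank (x : X) : ℕ := (exists_mem_pts x).choose.1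

lemma rank_eq {x : X} {c : Cell X} (h : x ∈ pts c) : rank x = c.1 :=
  congrArg Sigma.fst (eq_of_mem_pts (exists_mem_pts x).choose_spec h)

lemma rank_charMap_lt (c : Cell X) {v : Fin c.1 → ℝ} (hv : ‖v‖ = 1) :
    rank (charMap c v) < c.1 := by
  obtain ⟨I, hI⟩ := CWComplex.cellFrontier_subset_finite_openCell c.1 c.2
  have := hI (mem_image_of_mem _ (by simpa using hv) : charMap c v ∈ cellFrontier c.1 c.2)
  simp only [mem_iUnion] at this
  obtain ⟨m, hm, j, -, h⟩ := this
  rw [rank_eq (c := ⟨m, j⟩) h]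
  exact hm

end Cells

/-! ### The action on cells and equivariant coordinates. -/

section Action

variable {G : Type u} [Group G] {X : Type v} [TopologicalSpace X] [MulAction G X]
  [CWComplex (univ : Set X)] [hX : Fact (IsGCWComplex G X)]

noncomputable instance : SMul G (Cell X) where
  smul g c := ⟨c.1, (hX.out.smul_openCell g c.1 c.2).choose⟩

lemma pts_smul (g : G) (c : Cell X) : pts (g • c) = (fun x : X => g • x) '' pts c :=
  (hX.out.smul_openCell g c.1 c.2).choose_spec.symm

lemma smul_mem_pts (g : G) {c : Cell X} {x : X} (hx : x ∈ pts c) : g • x ∈ pts (g • c) := by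
  rw [pts_smul]
  exact mem_image_of_mem _ hx

@[simp] lemma fst_smul (g : G) (c : Cell X) : (g • c).1 = c.1 := rfl

noncomputable instance : MulAction G (Cell X) where
  one_smul c := eq_of_pts_eq (by simp [pts_smul])
  mul_smul g h c := eq_of_pts_eq (by simp only [pts_smul, image_image, mul_smul])

lemma rank_smul (g : G) (x : X) : rank (g • x) = rank x := by
  obtain ⟨c, hc⟩ := exists_mem_pts x
  rw [rank_eq hc, rank_eq (smul_mem_pts g hc), fst_smul]

/-- The fixed set of `g` is closed in a Hausdorff space, so it contains the closure of an open cell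
on which `g` is the identity. -/
lemma smul_eq_of_mem_closedCell {g : G} {c : Cell X} (h : g • c = c) {x : X}
    (hx : x ∈ closedCell c.1 c.2) : g • x = x := by
  have := hX.out.t2Space
  have := hX.out.continuousConstSMul
  rw [← closure_openCell_eq_closedCell] at hx
  have hcl : IsClosed {x : X | g • x = x} := isClosed_eq (continuous_const_smul g) continuous_id
  refine hcl.closure_subset_iff.2 (hX.out.smul_eq_self g c.1 c.2 ?_) hx
  exact (pts_smul g c).symm.trans (by rw [h])

lemma smul_eq_smul_of_mem_closedCell {g h : G} {c : Cell X} (hgh : g • c = h • c) {x : X}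
    (hx : x ∈ closedCell c.1 c.2) : g • x = h • x := by
  rw [← inv_smul_eq_iff, smul_smul] at hgh ⊢
  exact smul_eq_of_mem_closedCell hgh hx

variable (G) in
/-- The chosen representative of the orbit of a cell. -/
noncomputable def rep (c : Cell X) : Cell X :=
  (Quotient.mk (MulAction.orbitRel G (Cell X)) c).out

lemma exists_smul_rep (c : Cell X) : ∃ g : G, g • rep G c = c :=
  Setoid.symm' _ (Quotient.mk_out (s := MulAction.orbitRel G (Cell X)) c)

lemma rep_smul (g : G) (c : Cell X) : rep G (g • c) = rep G c :=
  congrArg Quotient.out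
    (Quotient.sound (s := MulAction.orbitRel G (Cell X)) ⟨g, rfl⟩ : Quotient.mk _ (g • c) = _)

lemma rep_rep (c : Cell X) : rep G (rep G c) = rep G c := by
  obtain ⟨g, hg⟩ := exists_smul_rep (G := G) c
  rw [← rep_smul g, hg]

lemma exists_coordinates (x : X) : ∃ (g : G) (c : Cell X) (v : Fin c.1 → ℝ),
    rep G c = c ∧ ‖v‖ < 1 ∧ x = g • charMap c v := by
  obtain ⟨e, he⟩ := exists_mem_pts x
  obtain ⟨g, hg⟩ := exists_smul_rep (G := G) e
  rw [← hg, pts_smul] at he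
  obtain ⟨-, ⟨v, hv, rfl⟩, rfl⟩ := he
  exact ⟨g, rep G e, v, rep_rep e, by simpa using hv, rfl⟩

/-- Characteristic maps need not be equivariant, so coordinates are transported from orbit
representatives. Only `g • c` is determined, not `g`, but group elements agreeing on `c` agree on
its closure. -/
lemma coordinates_unique {g g' : G} {c c' : Cell X} {v : Fin c.1 → ℝ} {v' : Fin c'.1 → ℝ}
    (hc : rep G c = c) (hc' : rep G c' = c') (hv : ‖v‖ < 1) (hv' : ‖v'‖ < 1)
    (h : g • charMap c v = g' • charMap c' v') :
    (⟨c, v⟩ : Σ c : Cell X, Fin c.1 → ℝ) = ⟨c', v'⟩ ∧ g • c = g' • c' := by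
  have h1 : g • c = g' • c' := eq_of_mem_pts (smul_mem_pts g (charMap_mem_pts c hv))
    (h ▸ smul_mem_pts g' (charMap_mem_pts c' hv'))
  obtain rfl : c = c' := by rw [← hc, ← hc', ← rep_smul g c, h1, rep_smul]
  refine ⟨?_, h1⟩
  rw [smul_eq_smul_of_mem_closedCell h1 (charMap_mem_closedCell c hv.le), smul_left_cancel_iff] at h
  rw [charMap_injOn c hv hv' h]

/-! ### The equivariant cover by thickened cells. -/

variable (G) in
/-- The point `x` lies in the closed set assigned to the cell `d`: the inner half of the cell `d`
together with the points in the outer half of a cell whose radial projection to the boundary lies in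
this set. -/
inductive Near : X → Cell X → Prop
  | core (g : G) (c : Cell X) (hc : rep G c = c) (v : Fin c.1 → ℝ) (hv : ‖v‖ ≤ 1 / 2) :
      Near (g • charMap c v) (g • c)
  | push (g : G) (c : Cell X) (hc : rep G c = c) (v : Fin c.1 → ℝ) (hv : 1 / 2 ≤ ‖v‖)
      (hv' : ‖v‖ < 1) (d : Cell X) (h : Near (g • charMap c (‖v‖⁻¹ • v)) d) :
      Near (g • charMap c v) d

lemma norm_inv_smul {n : ℕ} {v : Fin n → ℝ} (hv : 1 / 2 ≤ ‖v‖) : ‖‖v‖⁻¹ • v‖ = 1 := by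
  have : ‖v‖ ≠ 0 := by positivity
  rw [norm_smul, norm_inv, norm_norm, inv_mul_cancel₀ this]

lemma near_iff {g : G} {c : Cell X} (hc : rep G c = c) {v : Fin c.1 → ℝ} (hv : ‖v‖ < 1)
    {d : Cell X} : Near G (g • charMap c v) d ↔ (‖v‖ ≤ 1 / 2 ∧ d = g • c) ∨
      (1 / 2 ≤ ‖v‖ ∧ Near G (g • charMap c (‖v‖⁻¹ • v)) d) := by
  constructor
  · intro h
    generalize hx : g • charMap c v = x at h
    cases h with
    | core g' c' hc' v' hv' =>
      obtain ⟨h1, h2⟩ := coordinates_unique hc hc' hv (by linarith) hx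
      cases h1
      exact Or.inl ⟨hv', h2.symm⟩
    | push g' c' hc' v' hv1 hv2 _ h =>
      obtain ⟨h1, h2⟩ := coordinates_unique hc hc' hv hv2 hx
      cases h1
      rw [← smul_eq_smul_of_mem_closedCell h2
        (charMap_mem_closedCell c (norm_inv_smul hv1).le)] at h
      exact Or.inr ⟨hv1, h⟩
  · rintro (⟨h, rfl⟩ | ⟨h, h'⟩)
    · exact .core g c hc v h
    · exact .push g c hc v h hv d h'

lemma Near.smul {x : X} {d : Cell X} (h : Near G x d) (g : G) : Near G (g • x) (g • d) := by
  induction h with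
  | core g' c hc v hv =>
    rw [smul_smul, smul_smul]
    exact .core _ c hc v hv
  | push g' c hc v hv hv' d _ ih =>
    rw [smul_smul] at ih ⊢
    exact .push _ c hc v hv hv' _ ih

lemma near_smul_iff {x : X} {d : Cell X} {g : G} : Near G (g • x) d ↔ Near G x (g⁻¹ • d) :=
  ⟨fun h => by simpa using h.smul g⁻¹, fun h => by simpa using h.smul g⟩

/-- Induction on the dimension of the cell that contains a point. -/
lemma coordinates_induction {P : X → Prop}
    (h : ∀ (g : G) (c : Cell X) (v : Fin c.1 → ℝ), rep G c = c → ‖v‖ < 1 →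
      (1 / 2 ≤ ‖v‖ → rank (g • charMap c (‖v‖⁻¹ • v)) < c.1 ∧
        P (g • charMap c (‖v‖⁻¹ • v))) → P (g • charMap c v)) (x : X) : P x := by
  induction hn : rank x using Nat.strong_induction_on generalizing x with
  | _ n ih =>
    subst hn
    obtain ⟨g, c, v, hc, hv, rfl⟩ := exists_coordinates (G := G) x
    refine h g c v hc hv fun hv1 => ?_
    have h1 : rank (g • charMap c (‖v‖⁻¹ • v)) < c.1 := by
      rw [rank_smul]
      exact rank_charMap_lt c (norm_inv_smul hv1)
    refine ⟨h1, ih _ ?_ _ rfl⟩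
    rwa [rank_smul g (charMap c v), rank_eq (charMap_mem_pts c hv)]

variable (G) in
lemma exists_near (x : X) : ∃ d : Cell X, Near G x d := by
  refine coordinates_induction (G := G) (P := fun x => ∃ d : Cell X, Near G x d)
    (fun g c v hc hv ih => ?_) x
  rcases le_total ‖v‖ (1 / 2) with hv1 | hv1
  · exact ⟨_, .core g c hc v hv1⟩
  · obtain ⟨d, hd⟩ := (ih hv1).2
    exact ⟨d, .push g c hc v hv1 hv d hd⟩

lemma Near.dim_le {x : X} {d : Cell X} (h : Near G x d) : d.1 ≤ rank x := by
  revert h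
  refine coordinates_induction (G := G) (P := fun x => Near G x d → d.1 ≤ rank x)
    (fun g c v hc hv ih h => ?_) x
  rw [rank_smul g (charMap c v), rank_eq (charMap_mem_pts c hv)]
  rw [near_iff hc hv] at h
  rcases h with ⟨-, rfl⟩ | ⟨hv1, h⟩
  · exact le_rfl
  · exact ((ih hv1).2 h).trans (ih hv1).1.le

/-- A point in the inner half of its cell is near that cell; any other cell near it comes from the
radial projection and so has smaller dimension. -/
lemma Near.eq {x : X} {d e : Cell X} (hd : Near G x d) (he : Near G x e) (h : d.1 = e.1) :
    d = e := by
  revert hd he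
  refine coordinates_induction (G := G) (P := fun x => Near G x d → Near G x e → d = e)
    (fun g c v hc hv ih hd he => ?_) x
  rw [near_iff hc hv] at hd he
  rcases hd with ⟨-, rfl⟩ | ⟨hv1, hd⟩ <;> rcases he with ⟨-, rfl⟩ | ⟨hv2, he⟩
  · rfl
  · have := he.dim_le
    have := (ih hv2).1
    simp only [fst_smul] at h
    omega
  · have := hd.dim_le
    have := (ih hv1).1
    simp only [fst_smul] at h
    omega
  · exact (ih hv1).2 hd he

variable (G) in
/-- The points near to one of the cells in `S`. -/
def nearSet (S : Set (Cell X)) : Set X := {x | ∃ d ∈ S, Near G x d}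

lemma smul_mem_nearSet_iff {g : G} {S : Set (Cell X)} {x : X} :
    g • x ∈ nearSet G S ↔ x ∈ nearSet G ((fun d => g • d) ⁻¹' S) := by
  constructor
  · rintro ⟨d, hd, h⟩
    exact ⟨g⁻¹ • d, by simpa using hd, near_smul_iff.1 h⟩
  · rintro ⟨d, hd, h⟩
    exact ⟨g • d, hd, h.smul g⟩

lemma closedCell_smul (g : G) (c : Cell X) :
    closedCell (g • c).1 (g • c).2 = (fun x : X => g • x) '' closedCell c.1 c.2 := by
  have := hX.out.t2Space
  have := hX.out.continuousConstSMul
  rw [← closure_openCell_eq_closedCell, ← closure_openCell_eq_closedCell]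
  exact (congrArg closure (pts_smul g c)).trans ((Homeomorph.smul g).image_closure _).symm

/-- This extends `near_iff` to the boundary sphere, where the radial projection is the identity, so
that compactness of the closed ball can be used. -/
lemma charMap_mem_nearSet_iff {S : Set (Cell X)} {c : Cell X} (hc : rep G c = c)
    {v : Fin c.1 → ℝ} (hv : ‖v‖ ≤ 1) : charMap c v ∈ nearSet G S ↔
      (‖v‖ ≤ 1 / 2 ∧ c ∈ S) ∨ (1 / 2 ≤ ‖v‖ ∧ charMap c (‖v‖⁻¹ • v) ∈ nearSet G S) := by
  rcases hv.eq_or_lt with hv1 | hv1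
  · rw [hv1]
    norm_num
  · have := fun d => near_iff (g := (1 : G)) hc hv1 (d := d)
    simp only [one_smul] at this
    constructor
    · rintro ⟨d, hd, h⟩
      rcases (this d).1 h with ⟨h1, rfl⟩ | ⟨h1, h2⟩
      · exact Or.inl ⟨h1, hd⟩
      · exact Or.inr ⟨h1, d, hd, h2⟩
    · rintro (⟨h1, h2⟩ | ⟨h1, d, hd, h2⟩)
      · exact ⟨c, h2, (this c).2 (Or.inl ⟨h1, rfl⟩)⟩
      · exact ⟨d, hd, (this d).2 (Or.inr ⟨h1, h2⟩)⟩

/-- Induction on dimension: the frontier meets finitely many closed cells of lower dimension, so the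
trace there is closed. Pulled back along the radial projection it gives a compact part of the ball,
whose image is closed. -/
lemma isClosed_nearSet_inter_closedCell (S : Set (Cell X)) (c : Cell X) :
    IsClosed (nearSet G S ∩ closedCell c.1 c.2) := by
  have := hX.out.t2Space
  have := hX.out.continuousConstSMul
  obtain ⟨n, hn⟩ : ∃ n, c.1 = n := ⟨_, rfl⟩
  induction n using Nat.strong_induction_on generalizing c S with
  | _ n ih =>
    subst hn
    -- Translating `c` to its representative also translates `S`, so `S` has to vary.
    wlog hc : rep G c = c generalizing c S
    · obtain ⟨g, hg⟩ := exists_smul_rep (G := G) c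
      have := this ((fun d => g • d) ⁻¹' S) (rep G c) (by
        intro m hm S' c' hc'
        refine ih m ?_ S' c' hc'
        rwa [← hg, fst_smul]) (rep_rep c)
      rw [← (Homeomorph.smul g).isClosed_image] at this
      convert this using 1
      conv_lhs => rw [← hg, closedCell_smul]
      ext x
      constructor
      · rintro ⟨hx, y, hy, rfl⟩
        exact ⟨y, ⟨smul_mem_nearSet_iff.1 hx, hy⟩, rfl⟩
      · rintro ⟨y, ⟨hy, hy'⟩, rfl⟩
        exact ⟨smul_mem_nearSet_iff.2 hy, y, hy', rfl⟩
    have hfr : IsClosed (nearSet G S ∩ cellFrontier c.1 c.2) := by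
      obtain ⟨I, hI⟩ := CWComplex.cellFrontier_subset_finite_closedCell c.1 c.2
      rw [← inter_eq_right.2 hI, ← inter_assoc]
      refine IsClosed.inter ?_ isClosed_cellFrontier
      simp only [inter_iUnion]
      refine (finite_lt_nat c.1).isClosed_biUnion fun m hm => ?_
      exact (I m).finite_toSet.isClosed_biUnion fun j _ => ih m hm S ⟨m, j⟩ rfl
    have hcont : ContinuousOn (charMap c) (closedBall 0 1) := RelCWComplex.continuousOn c.1 c.2
    have hproj : ContinuousOn (fun v : Fin c.1 → ℝ => charMap c (‖v‖⁻¹ • v)) {v | 1 / 2 ≤ ‖v‖} := by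
      refine hcont.comp (f := fun v : Fin c.1 → ℝ => ‖v‖⁻¹ • v) ?_ ?_
      · refine ContinuousOn.smul (continuous_norm.continuousOn.inv₀ fun v hv => ?_) continuousOn_id
        have : (1 : ℝ) / 2 ≤ ‖v‖ := hv
        positivity
      · intro v hv
        simpa using (norm_inv_smul hv).le
    have hcl : IsClosed {v : Fin c.1 → ℝ | 1 / 2 ≤ ‖v‖} :=
      isClosed_le continuous_const continuous_norm
    have hB := hproj.preimage_isClosed_of_isClosed hcl hfr
    have hA : IsClosed {v : Fin c.1 → ℝ | ‖v‖ ≤ 1 / 2 ∧ c ∈ S} := by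
      by_cases h : c ∈ S
      · simpa [h] using isClosed_le continuous_norm continuous_const
      · simp [h]
    have himage : nearSet G S ∩ closedCell c.1 c.2 = charMap c '' (closedBall 0 1 ∩
        ({v : Fin c.1 → ℝ | ‖v‖ ≤ 1 / 2 ∧ c ∈ S} ∪ ({v : Fin c.1 → ℝ | 1 / 2 ≤ ‖v‖} ∩
          (fun v : Fin c.1 → ℝ => charMap c (‖v‖⁻¹ • v)) ⁻¹'
            (nearSet G S ∩ cellFrontier c.1 c.2)))) := by
      ext x
      constructor
      · rintro ⟨hx, v, hv, rfl⟩
        rw [mem_closedBall_zero_iff] at hv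
        refine ⟨v, ⟨by simpa using hv, ?_⟩, rfl⟩
        refine ((charMap_mem_nearSet_iff hc hv).1 hx).imp id fun h => ⟨h.1, h.2, ?_⟩
        exact mem_image_of_mem _ (by simpa using norm_inv_smul h.1)
      · rintro ⟨v, ⟨hv, h⟩, rfl⟩
        rw [mem_closedBall_zero_iff] at hv
        exact ⟨(charMap_mem_nearSet_iff hc hv).2 (h.imp id fun h => ⟨h.1, h.2.1⟩),
          charMap_mem_closedCell c hv⟩
    rw [himage]
    refine IsCompact.isClosed (IsCompact.image_of_continuousOn ?_ (hcont.mono inter_subset_left))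
    exact (isCompact_closedBall _ _).inter_right (hA.union hB)

lemma isClosed_nearSet (S : Set (Cell X)) : IsClosed (nearSet G S) := by
  have := hX.out.t2Space
  rw [CWComplex.closed univ _ (subset_univ _)]
  exact fun n j => isClosed_nearSet_inter_closedCell S ⟨n, j⟩

end Action

end IsGCWComplex

/-! ### Minimal noncyclic subquotients and orbits of a single element. -/

section Groups

/-- A finite group all of whose proper subgroups are cyclic is solvable. -/
lemma isSolvable_of_forall_isCyclic {Q : Type*} [Group Q] [Finite Q]
    (h : ∀ J : Subgroup Q, J < ⊤ → IsCyclic J) : Group.IsSolvable Q := by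
  by_cases hp : ∃ p : ℕ, p.Prime ∧ IsPGroup p Q
  · obtain ⟨p, hp, hQ⟩ := hp
    have := Fact.mk hp
    have := hQ.isNilpotent
    infer_instance
  -- If `Q` is not a `p`-group, its Sylow subgroups are proper, hence cyclic.
  · have : IsZGroup Q := by
      refine ⟨fun p hp' P => h P (lt_top_iff_ne_top.2 fun hP => hp ⟨p, hp', ?_⟩)⟩
      have := P.isPGroup'
      rw [hP] at this
      exact this.of_equiv Subgroup.topEquiv
    infer_instance

/-- A nontrivial finite group all of whose proper subgroups are cyclic has a proper normal subgroup
`J` and an element of prime order modulo `J` that generates the group together with `J`. -/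
lemma exists_normal_sup_zpowers_eq_top {Q : Type*} [Group Q] [Finite Q] [Nontrivial Q]
    (h : ∀ J : Subgroup Q, J < ⊤ → IsCyclic J) :
    ∃ (J : Subgroup Q) (p : ℕ) (t : Q), J.Normal ∧ J < ⊤ ∧ p.Prime ∧ t ^ p ∈ J ∧
      J ⊔ Subgroup.zpowers t = ⊤ := by
  have := isSolvable_of_forall_isCyclic h
  -- A maximal subgroup above the commutator subgroup is normal, and by maximality any element
  -- outside it generates the group together with it.
  obtain ⟨J, hJ, hle⟩ := (eq_top_or_exists_le_coatom (commutator Q)).resolve_left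
    (Group.IsSolvable.commutator_lt_top_of_nontrivial Q).ne
  have hn : J.Normal := Subgroup.Normal.of_commutator_le Q hle
  have hidx : J.index ≠ 1 := fun h => hJ.1 (Subgroup.index_eq_one.1 h)
  obtain ⟨p, hp, hdvd⟩ := Nat.exists_prime_and_dvd hidx
  have := Fact.mk hp
  obtain ⟨s, hs⟩ := exists_prime_orderOf_dvd_card' (G := Q ⧸ J) p hdvd
  obtain ⟨t, rfl⟩ := QuotientGroup.mk_surjective s
  refine ⟨J, p, t, hn, hJ.lt_top, hp, ?_, hJ.2 _ ?_⟩
  · rw [← QuotientGroup.eq_one_iff, QuotientGroup.mk_pow, ← hs, pow_orderOf_eq_one]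
  · refine left_lt_sup.2 fun hle => ?_
    have ht : t ∈ J := hle (Subgroup.mem_zpowers t)
    rw [← QuotientGroup.eq_one_iff] at ht
    rw [ht, orderOf_one] at hs
    exact hp.one_lt.ne hs

/-- A virtually cyclic group that is not cyclic contains a noncyclic subgroup that is an extension
of a cyclic group by a group of prime order. -/
lemma IsVirtuallyCyclic.exists_not_isCyclic_sup {V : Type*} [Group V] (hV : IsVirtuallyCyclic V)
    (hc : ¬ IsCyclic V) :
    ∃ (M : Subgroup V) (p : ℕ) (t : V), IsCyclic M ∧ p.Prime ∧ (∀ m ∈ M, t⁻¹ * m * t ∈ M) ∧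
      t ^ p ∈ M ∧ ¬ IsCyclic (M ⊔ Subgroup.zpowers t : Subgroup V) := by
  obtain ⟨H, hH, hfin⟩ := hV
  have hN : IsCyclic H.normalCore := Subgroup.isCyclic_of_le H.normalCore_le
  let π := QuotientGroup.mk' H.normalCore
  have hπ : Function.Surjective π := QuotientGroup.mk'_surjective _
  have hker : ∀ K : Subgroup (V ⧸ H.normalCore), π.ker ≤ K.comap π := fun K =>
    (MonoidHom.comap_bot π).symm.trans_le (Subgroup.comap_mono bot_le)
  -- Minimality is taken in the finite quotient; `V` itself need not have minimal noncyclic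
  -- subgroups.
  obtain ⟨K, hK⟩ :=
    (toFinite {K : Subgroup (V ⧸ H.normalCore) | ¬ IsCyclic (K.comap π)}).exists_minimal
    ⟨⊤, fun h => hc (by
      rw [Subgroup.comap_top] at h
      exact isCyclic_of_surjective (Subgroup.topEquiv (G := V)).toMonoidHom
        Subgroup.topEquiv.surjective)⟩
  have hmin : ∀ J < K, IsCyclic (J.comap π) := fun J hJ => by
    by_contra h
    exact hJ.not_ge (hK.2 h hJ.le)
  have hlt : ∀ J : Subgroup K, J < ⊤ → J.map K.subtype < K := fun J hJ => by
    refine lt_of_le_of_ne (Subgroup.map_subtype_le J) fun h => hJ.ne ?_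
    rw [eq_top_iff]
    intro x _
    have hx : (x : V ⧸ H.normalCore) ∈ J.map K.subtype := by rw [h]; exact x.2
    obtain ⟨y, hy, hyx⟩ := hx
    rwa [← Subtype.ext hyx]
  have hproper : ∀ J : Subgroup K, J < ⊤ → IsCyclic J := fun J hJ => by
    have h1 := hmin _ (hlt J hJ)
    have h2 : IsCyclic (J.map K.subtype) := isCyclic_of_surjective
      (π.subgroupComap (J.map K.subtype))
      (π.subgroupComap_surjective_of_surjective _ hπ)
    let e := J.equivMapOfInjective K.subtype K.subtype_injective
    exact isCyclic_of_injective e.toMonoidHom e.injective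
  have hnt : Nontrivial K := by
    rw [Subgroup.nontrivial_iff_ne_bot]
    rintro rfl
    refine hK.1 ?_
    rwa [MonoidHom.comap_bot, QuotientGroup.ker_mk']
  obtain ⟨J, p, t₀, hJn, hJ, hp, htp, hsup⟩ := exists_normal_sup_zpowers_eq_top hproper
  obtain ⟨t, ht⟩ := hπ t₀
  refine ⟨(J.map K.subtype).comap π, p, t, hmin _ (hlt J hJ), hp, fun m hm => ?_, ?_,
    fun h => hK.1 ?_⟩
  · obtain ⟨j, hj, hjm⟩ := hm
    refine ⟨t₀⁻¹ * j * t₀, ?_, ?_⟩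
    · simpa using hJn.conj_mem j hj t₀⁻¹
    · simp only [map_mul, map_inv, ht, ← hjm]
      rfl
  · refine ⟨t₀ ^ p, htp, ?_⟩
    simp only [map_pow, ht]
    rfl
  -- This subgroup contains the kernel and has image `K`, so it is the noncyclic preimage of `K`.
  · have hle : π.ker ≤ (J.map K.subtype).comap π ⊔ Subgroup.zpowers t := (hker _).trans le_sup_left
    rw [← Subgroup.comap_map_eq_self hle, Subgroup.map_sup,
      Subgroup.map_comap_eq_self_of_surjective hπ, MonoidHom.map_zpowers, ht,
      show (t₀ : V ⧸ H.normalCore) = K.subtype t₀ from rfl, ← MonoidHom.map_zpowers,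
      ← Subgroup.map_sup, hsup, ← MonoidHom.range_eq_map, Subgroup.range_subtype] at h
    exact h

/-- If an element `t` acts, then there is a map to the cyclic group of order `p` that is equivariant
on the points with `t`-orbit of length `p`. -/
lemma exists_map_smul_eq_add_one {G Z : Type*} [Group G] [MulAction G Z] (t : G) {p : ℕ}
    (hp : p.Prime) :
    ∃ a : Z → ZMod p, ∀ c, t ^ p • c = c → t • c ≠ c → a (t • c) = a c + 1 := by
  let S := MulAction.orbitRel (Subgroup.zpowers t) Z
  let r : Z → Z := fun c => (Quotient.mk S c).out
  have hr : ∀ c, ∃ m : ℤ, t ^ m • r c = c := fun c => by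
    obtain ⟨⟨_, m, rfl⟩, hm⟩ := S.symm (Quotient.mk_out (s := S) c)
    exact ⟨m, hm⟩
  choose m hm using hr
  -- The exponent that carries the orbit representative to `c` is well defined modulo the period,
  -- which is `p` for the relevant `c`.
  refine ⟨fun c => (m c : ZMod p), fun c hc hc' => ?_⟩
  have hrt : r (t • c) = r c := congrArg Quotient.out
    (Quotient.sound (s := S) ⟨⟨t, Subgroup.mem_zpowers t⟩, rfl⟩ : Quotient.mk S (t • c) = _)
  have hper : MulAction.period t c = p := by
    refine (hp.eq_one_or_self_of_dvd _ (MulAction.pow_smul_eq_iff_period_dvd.1 hc)).resolve_left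
      fun h => hc' ?_
    rw [← pow_one t, MulAction.pow_smul_eq_iff_period_dvd, h]
  have h1 : t ^ (m (t • c) - m c - 1) • c = c := by
    have h2 : r c = t ^ (- m c) • c := by
      rw [zpow_neg, eq_inv_smul_iff, hm]
    have h3 := hm (t • c)
    rw [hrt, h2, smul_smul, ← zpow_add] at h3
    rw [← smul_left_cancel_iff t, smul_smul, ← zpow_one_add,
      show 1 + (m (t • c) - m c - 1) = m (t • c) + -m c by ring, h3]
  rw [MulAction.zpow_smul_eq_iff_period_dvd, hper, ← ZMod.intCast_zmod_eq_zero_iff_dvd] at h1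
  push_cast at h1
  linear_combination h1

end Groups

/-! ### Fixed points of elements of prime order modulo a subgroup. -/

section FixedPoints

open IsGCWComplex

/-- A finite-dimensional `G`-CW-complex `X` such that `X^M` is contractible: an element of prime
order modulo `M` that normalizes `M` has a fixed point in `X^M`. -/
theorem IsGCWComplex.exists_fixedPoint {G : Type u} [Group G] {X : Type v} [TopologicalSpace X]
    [MulAction G X] [CWComplex (univ : Set X)] (hX : IsGCWComplex G X)
    (hfin : CWComplex.FiniteDimensional (univ : Set X)) {M : Subgroup G} {p : ℕ} {t : G}
    (hp : p.Prime) (hM : ∀ m ∈ M, t⁻¹ * m * t ∈ M) (htp : t ^ p ∈ M)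
    (hcon : ContractibleSpace (MulAction.fixedPoints M X)) :
    ∃ x ∈ MulAction.fixedPoints M X, t • x = x := by
  by_contra! hno
  have : Fact (IsGCWComplex G X) := ⟨hX⟩
  have := hX.continuousConstSMul
  have : NeZero p := ⟨hp.ne_zero⟩
  have : Fact (1 < p) := ⟨hp.one_lt⟩
  have hfix : ∀ y ∈ MulAction.fixedPoints M X, ∀ m ∈ M, m • y = y := fun y hy m hm => hy ⟨m, hm⟩
  let h : MulAction.fixedPoints M X → MulAction.fixedPoints M X := fun y => ⟨t • y.1, fun m => by
    have := hfix y.1 y.2 _ (hM m m.2)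
    rwa [mul_assoc, mul_smul, inv_smul_eq_iff, mul_smul] at this⟩
  have hval : ∀ i y, (h^[i] y).1 = t ^ i • y.1 := by
    intro i y
    induction i with
    | zero => simp
    | succ i ih => rw [Function.iterate_succ_apply', pow_succ', mul_smul, ← ih]
  have hlow : ∀ x : X, ∃ d : Cell X, Near G x d ∧ ∀ e, Near G x e → d.1 ≤ e.1 := by
    intro x
    have hne : {d : Cell X | Near G x d}.Nonempty := exists_near G x
    obtain ⟨d, hd, hmin⟩ := (measure (Sigma.fst : Cell X → ℕ)).wf.has_min _ hne
    exact ⟨d, hd, fun e he => not_lt.1 (hmin e he)⟩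
  choose low hnear hmin using hlow
  have hsmul : ∀ (g : G) (x : X), low (g • x) = g • low x := by
    intro g x
    refine (hnear (g • x)).eq ((hnear x).smul g) (le_antisymm ?_ ?_)
    · exact hmin _ _ ((hnear x).smul g)
    · exact hmin x (g⁻¹ • low (g • x)) (near_smul_iff.1 (hnear _))
  obtain ⟨a, ha⟩ := exists_map_smul_eq_add_one (Z := Cell X) t hp
  have hcell : ∀ y ∈ MulAction.fixedPoints M X, ∀ m ∈ M, m • low y = low y := by
    intro y hy m hm
    rw [← hsmul, hfix y hy m hm]
  -- Otherwise the centre of the cell `low y` would be fixed by `M` and `t`.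
  have hmove : ∀ y ∈ MulAction.fixedPoints M X, t • low y ≠ low y := by
    intro y hy ht
    have hmem : charMap (low y) 0 ∈ RelCWComplex.closedCell (low y).1 (low y).2 :=
      charMap_mem_closedCell _ (by simp)
    exact hno _ (fun m => smul_eq_of_mem_closedCell (hcell y hy m m.2) hmem)
      (smul_eq_of_mem_closedCell ht hmem)
  obtain ⟨D, hD⟩ := Filter.eventually_atTop.1 hfin.eventually_isEmpty_cell
  refine ListChain.not_semiconj_shift (p := p) (h := h) ?_ ?_ D
    (fun y => ((low y.1).1, a (low y.1))) ?_ ?_ ?_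
  · exact (continuous_const_smul t).comp continuous_subtype_val |>.subtype_mk _
  · ext y
    rw [hval]
    exact hfix y.1 y.2 _ htp
  · intro y
    by_contra hle
    exact (hD _ (not_lt.1 hle)).elim (low y.1).2
  · intro y
    have h1 := ha (low y.1) (hcell y.1 y.2 _ htp) (hmove y.1 y.2)
    ext
    · have h2 := congrArg Sigma.fst (hsmul t y.1)
      exact h2
    · exact (congrArg a (hsmul t y.1)).trans h1
  · intro y
    -- On this open neighbourhood of `y`, a point is near only to cells that `y` is near to, and `y`
    -- is near to at most one cell of each dimension.
    have hopen := (isClosed_nearSet (G := G) {d : Cell X | ¬ Near G y.1 d}).isOpen_compl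
    refine ⟨Subtype.val ⁻¹' (nearSet G {d : Cell X | ¬ Near G y.1 d})ᶜ,
      (hopen.preimage continuous_subtype_val).mem_nhds ?_, ?_⟩
    · rintro ⟨d, hd, hd'⟩
      exact hd hd'
    · intro b hb c hc hbc
      have hb' : Near G y.1 (low b.1) := by
        by_contra hcon
        exact hb ⟨_, hcon, hnear _⟩
      have hc' : Near G y.1 (low c.1) := by
        by_contra hcon
        exact hc ⟨_, hcon, hnear _⟩
      simp only at hbc ⊢
      rw [hb'.eq hc' hbc]

end FixedPoints

/-! ### The two directions of the theorem. -/

/-- A virtually cyclic group with a finite-dimensional model for the classifying space of the family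
of cyclic subgroups is cyclic. -/
theorem IsVirtuallyCyclic.isCyclic_of_hasFiniteDimensionalModel {V : Type u} [Group V]
    (hV : IsVirtuallyCyclic V) (h : HasFiniteDimensionalModel.{u, v} (cyclicFamily V)) :
    IsCyclic V := by
  by_contra hc
  obtain ⟨M, p, t, hM, hp, hconj, htp, hnc⟩ := hV.exists_not_isCyclic_sup hc
  obtain ⟨X, _, _, _, hmodel, hfin⟩ := h
  obtain ⟨x, hx, hxt⟩ :=
    hmodel.isGCWComplex.exists_fixedPoint hfin hp hconj htp (hmodel.contractible M hM)
  have hle : M ⊔ Subgroup.zpowers t ≤ MulAction.stabilizer V x := by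
    rw [sup_le_iff, Subgroup.zpowers_le]
    exact ⟨fun m hm => hx ⟨m, hm⟩, hxt⟩
  have hmem : x ∈ MulAction.fixedPoints (M ⊔ Subgroup.zpowers t : Subgroup V) X :=
    fun g => hle g.2
  rw [hmodel.empty _ hnc] at hmem
  exact hmem

/-- The one-point space is a model for the classifying space of the family of cyclic subgroups of a
cyclic group. -/
theorem hasFiniteDimensionalModel_of_isCyclic {V : Type u} [Group V] (hV : IsCyclic V) :
    HasFiniteDimensionalModel.{u, v} (cyclicFamily V) := by
  let act : MulAction V PUnit.{v + 1} :=
    { smul := fun _ x => x, one_smul := fun _ => rfl, mul_smul := fun _ _ _ => rfl }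
  have himage : ∀ (g : V) (s : Set PUnit.{v + 1}), (fun x => g • x) '' s = s := fun _ s =>
    image_id s
  refine ⟨PUnit.{v + 1}, inferInstance, act, inferInstance, ⟨⟨inferInstance, ⟨fun _ =>
    continuous_id⟩, fun g n i => ⟨i, himage g _⟩, fun _ _ _ _ _ _ => rfl⟩, fun H _ => ?_,
    fun H hH => (hH (Subgroup.isCyclic H)).elim⟩, ⟨?_⟩⟩
  · have : Unique (MulAction.fixedPoints H PUnit.{v + 1}) :=
      { default := ⟨PUnit.unit, fun _ => rfl⟩, uniq := fun _ => rfl }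
    infer_instance
  · filter_upwards [Filter.eventually_ge_atTop 1] with n hn
    obtain ⟨n, rfl⟩ := Nat.exists_eq_add_of_le' hn
    exact inferInstanceAs (IsEmpty PEmpty)

theorem mainTheorem9 :
    (∀ (G : Type u) [Group G] [Finite G],
      HasFiniteDimensionalModel.{u, v} (cyclicFamily G) → IsCyclic G) ∧
    (∀ (V : Type u) [Group V], IsVirtuallyCyclic V →
      (HasFiniteDimensionalModel.{u, v} (cyclicFamily V) ↔ IsCyclic V)) := by
  refine ⟨fun G _ _ h => ?_, fun V _ hV =>
    ⟨hV.isCyclic_of_hasFiniteDimensionalModel, hasFiniteDimensionalModel_of_isCyclic⟩⟩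
  have hG : IsVirtuallyCyclic G := ⟨⊥, inferInstance, inferInstance⟩
  exact hG.isCyclic_of_hasFiniteDimensionalModel h
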